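/- Let $G=(V,E)$ be a simple graph whose vertex set $V$ is a compact Hausdorff topological space, and suppose that $G$ is a topological packing graph: every finite clique is contained in an open subset of $V$ that is itself a clique. Let $\alpha(G)$ be the supremum of the cardinalities of independent sets of $G$. For $t\in\mathbb N_0$ let $\mathrm{sub}_t(V)$ be the set of subsets of $V$ with at most $t$ elements; its nonempty members carry the quotient topology under $V^t\to \mathrm{sub}_t(V)$, $(v_1,\dots,v_t)\mapsto\{v_1,\dots,v_t\}$, and $\emptyset$ is added as an isolated point by a disjoint union. Let $I_t\subseteq\mathrm{sub}_t(V)$ be the subspace of independent sets with at most $t$ elements, and let $I_{=1}$ be the set of one-element independent sets. A symmetric continuous kernel $K\colon I_t\times I_t\to\mathbb R$ is positive definite if $(K(J_i,J_j))_{i,j=1}^m$ is positive semidefinite for all $m$ and all $J_1,\dots,J_m\in I_t$. For a continuous $K\colon I_t\times I_t\to\mathbb R$ and $S\in I_{2t}$ put $$A_tK(S)=\sum_{J,J'\in I_t:\ J\cup J'=S}K(J,J').$$ Let $$\mathrm{las}_t(G)=\sup\lambda(I_{=1})\in[0,\infty],$$ where $\lambda$ runs over the (positive) Radon measures on $I_{2t}$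 (locally finite Borel measures, inner regular with respect to compact sets) with $\lambda(\{\emptyset\})=1$ and such that $A_t^*\lambda$ is positive definite, that is, $\langle K,A_t^*\lambda\rangle=\int_{I_{2t}} A_tK\,d\lambda\ge 0$ for every positive definite kernel $K$ on $I_t$. Then $\alpha(G)$ is finite (and attained), $A_tK$ is continuous on $I_{2t}$ for every $t$ and every continuous $K$, and $$\mathrm{las}_{\alpha(G)}(G)=\alpha(G).$$ Moreover $\mathrm{las}_t(G)\ge\alpha(G)$ and $\mathrm{las}_{t+1}(G)\le\mathrm{las}_t(G)$ for every $t\ge 1$, and $\mathrm{las}_t(G)=\alpha(G)$ for every $t\ge\alpha(G)$; so the nonincreasing chain $\mathrm{las}_1(G)\ge\mathrm{las}_2(G)\ge\cdots$ reaches $\alpha(G)$ after finitely many steps. -/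

import Mathlib

open MeasureTheory
open scoped ENNReal

namespace PackingGraph

noncomputable section

/-- Each finite clique is contained in an open clique. The Hausdorff property of the vertex space
is a separate type class assumption. -/
def IsTopologicalPackingGraph {V : Type*} [TopologicalSpace V] (G : SimpleGraph V) : Prop :=
  ∀ s : Finset V, G.IsClique (s : Set V) →
    ∃ U : Set V, IsOpen U ∧ (s : Set V) ⊆ U ∧ G.IsClique U

/-- `sub_t(V)`: the subsets of `V` with at most `t` elements. -/
def SubsetsLE (V : Type*) (t : ℕ) : Type _ := {s : Finset V // s.card ≤ t}

/-- The map `q` sending `(v₁, …, v_t)` to `{v₁, …, v_t}`, together with one extra isolated point,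
which is sent to the empty set. -/
def toSubsetsLE (V : Type*) (t : ℕ) : (Fin t → V) ⊕ Unit → SubsetsLE V t :=
  letI : DecidableEq V := Classical.decEq V
  Sum.elim
    (fun v => ⟨Finset.univ.image v, Finset.card_image_le.trans (by simp)⟩)
    (fun _ => ⟨∅, by simp⟩)

/-- For `t ≥ 1`: the quotient topology from `V ^ t` on the nonempty subsets, and the empty set added
by a disjoint union. For `t = 0` the space is the single point `∅`. -/
instance (V : Type*) [TopologicalSpace V] (t : ℕ) : TopologicalSpace (SubsetsLE V t) :=
  TopologicalSpace.coinduced (toSubsetsLE V t) inferInstance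

instance (V : Type*) [TopologicalSpace V] (t : ℕ) : MeasurableSpace (SubsetsLE V t) :=
  borel _

instance (V : Type*) [TopologicalSpace V] (t : ℕ) : BorelSpace (SubsetsLE V t) :=
  ⟨rfl⟩

/-- `I_t`: the independent sets with at most `t` elements, with the subspace topology of
`sub_t(V)` and the Borel σ-algebra. -/
abbrev IndepSets {V : Type*} (G : SimpleGraph V) (t : ℕ) : Type _ :=
  {S : SubsetsLE V t // G.IsIndepSet (S.1 : Set V)}

/-- The underlying finite set of vertices. -/
def IndepSets.toFinset {V : Type*} {G : SimpleGraph V} {t : ℕ} (S : IndepSets G t) : Finset V :=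
  S.1.1

/-- `I_{=k}` as a subset of `I_t`. -/
def indepSetsOfCard {V : Type*} (G : SimpleGraph V) (t k : ℕ) : Set (IndepSets G t) :=
  {S | S.toFinset.card = k}

/-- The pairs `(J, J')` in `I_t × I_t` with `J ∪ J' = S`. -/
def unionPairs {V : Type*} (G : SimpleGraph V) (t : ℕ) (S : IndepSets G (2 * t)) :
    Set (IndepSets G t × IndepSets G t) :=
  letI : DecidableEq V := Classical.decEq V
  {p | p.1.toFinset ∪ p.2.toFinset = S.toFinset}

theorem unionPairs_finite {V : Type*} (G : SimpleGraph V) (t : ℕ) (S : IndepSets G (2 * t)) :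
    (unionPairs G t S).Finite := by
  letI : DecidableEq V := Classical.decEq V
  refine Set.Finite.of_finite_image (f := fun p => (p.1.toFinset, p.2.toFinset)) ?_ ?_
  · refine Set.Finite.subset (S.toFinset.powerset ×ˢ S.toFinset.powerset).finite_toSet ?_
    rintro _ ⟨p, hp, rfl⟩
    have hp' : p.1.toFinset ∪ p.2.toFinset = S.toFinset := hp
    rw [Finset.mem_coe, Finset.mem_product, Finset.mem_powerset, Finset.mem_powerset, ← hp']
    exact ⟨Finset.subset_union_left, Finset.subset_union_right⟩
  · rintro ⟨a, b⟩ _ ⟨c, d⟩ _ h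
    simp only [Prod.mk.injEq] at h
    exact Prod.ext (Subtype.ext (Subtype.ext h.1)) (Subtype.ext (Subtype.ext h.2))

/-- The operator `A_t`: `A_t K (S)` is the sum of `K (J, J')` over all `J, J' ∈ I_t` with
`J ∪ J' = S`. -/
def unionSum {V : Type*} [TopologicalSpace V] (G : SimpleGraph V) (t : ℕ)
    (K : C(IndepSets G t × IndepSets G t, ℝ)) (S : IndepSets G (2 * t)) : ℝ :=
  ∑ p ∈ (unionPairs_finite G t S).toFinset, K p

/-- The continuous symmetric positive definite kernels. -/
structure IsPosDefKernel {X : Type*} [TopologicalSpace X] (K : C(X × X, ℝ)) : Prop where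
  symm : ∀ x y, K (x, y) = K (y, x)
  posSemidef : ∀ (m : ℕ) (x : Fin m → X), (Matrix.of fun i j => K (x i, x j)).PosSemidef

/-- The adjoint `A_t^*`, with `A_t^* ν` as a functional on kernels:
`⟨K, A_t^* ν⟩ = ⟨A_t K, ν⟩ = ∫ A_t K dν`. -/
def adjointPairing {V : Type*} [TopologicalSpace V] (G : SimpleGraph V) (t : ℕ)
    (ν : Measure (IndepSets G (2 * t))) (K : C(IndepSets G t × IndepSets G t, ℝ)) : ℝ :=
  ∫ S, unionSum G t K S ∂ν

/-- Feasible solutions of the `t`-th step: Radon measures `ν` on `I_{2t}` (locally finite and inner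
regular with respect to compact sets) with `ν {∅} = 1` and `A_t^* ν` in the dual cone of the cone of
positive definite kernels. -/
structure IsFeasible {V : Type*} [TopologicalSpace V] (G : SimpleGraph V) (t : ℕ)
    (ν : Measure (IndepSets G (2 * t))) : Prop where
  locallyFinite : IsLocallyFiniteMeasure ν
  innerRegular : ν.InnerRegular
  normalized : ν {S | S.toFinset = ∅} = 1
  posDef : ∀ K : C(IndepSets G t × IndepSets G t, ℝ), IsPosDefKernel K →
    0 ≤ adjointPairing G t ν K

/-- `las_t(G)`: the supremum of `ν (I_{=1})` over all feasible `ν`, in `[0, ∞]`. -/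
def las {V : Type*} [TopologicalSpace V] (G : SimpleGraph V) (t : ℕ) : ℝ≥0∞ :=
  ⨆ (ν : Measure (IndepSets G (2 * t))) (_ : IsFeasible G t ν), ν (indepSetsOfCard G (2 * t) 1)

end

end PackingGraph

open Filter Topology

namespace PackingGraph

noncomputable section

attribute [local instance 10] Classical.decEq

/-! ### Pairs of finite sets with a given union -/

/-! Upper bound, for t ≥ α: choose f so that the sum of f(|Q|) over Q ⊆ R is √(α - |R|) whenever |R|
≤ α. The rank-one kernel K(J, J') = f(|J|) f(|J'|) is positive definite. Summing A_tK over all S ⊆ R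
groups the pairs J, J' ⊆ R by their union, so the total is the square of that sum, namely α - |R|.
Möbius inversion (`sum_coverPairs_mul_eq`) then forces A_tK to be α at ∅, -1 at singletons and 0
elsewhere. Pairing with a feasible λ gives 0 ≤ α - λ(I_{=1}).

Lower bound: for a maximum independent set R, the sum of the point masses at all Q ⊆ R with |Q| ≤ 2t
is feasible. By the same grouping (`sum_powerset_sum_coverPairs`), its pairing with K is the sum of
all entries of a positive semidefinite matrix.

Monotonicity: restrict a feasible measure to the sets of size at most 2s and regard it on I_{2s};
its feasibility is tested on kernels extended by zero.

The topological input is `exists_eventually_injOn`: near an independent tuple, equal entries stay in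
a common open clique and hence stay equal, while distinct entries stay distinct by the Hausdorff
property. So cardinality is locally constant, and A_tK is locally a sum of continuous functions over
a fixed finite index set. -/

/-- The pairs of finite sets with at most `t` elements whose union is `S`. -/
def coverPairs {ι : Type*} [DecidableEq ι] (t : ℕ) (S : Finset ι) : Finset (Finset ι × Finset ι) :=
  {p ∈ S.powerset ×ˢ S.powerset | p.1 ∪ p.2 = S ∧ p.1.card ≤ t ∧ p.2.card ≤ t}

theorem mem_coverPairs {ι : Type*} [DecidableEq ι] {t : ℕ} {S : Finset ι}
    {p : Finset ι × Finset ι} :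
    p ∈ coverPairs t S ↔ p.1 ∪ p.2 = S ∧ p.1.card ≤ t ∧ p.2.card ≤ t := by
  simp only [coverPairs, Finset.mem_filter, Finset.mem_product, Finset.mem_powerset,
    and_iff_right_iff_imp]
  rintro ⟨rfl, -, -⟩
  exact ⟨Finset.subset_union_left, Finset.subset_union_right⟩

theorem card_le_of_mem_coverPairs {ι : Type*} [DecidableEq ι] {t : ℕ} {S : Finset ι}
    {p : Finset ι × Finset ι} (hp : p ∈ coverPairs t S) : S.card ≤ 2 * t := by
  obtain ⟨h, h₁, h₂⟩ := mem_coverPairs.1 hp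
  have := Finset.card_union_le p.1 p.2
  rw [h] at this
  omega

/-- Moves a sum indexed by subsets of a varying vertex set to a fixed index set `T`; this is what
makes continuity of A_tK visible. -/
theorem sum_coverPairs_image {ι κ M : Type*} [DecidableEq ι] [DecidableEq κ] [AddCommMonoid M]
    (t : ℕ) {T : Finset ι} {v : ι → κ} (hv : Set.InjOn v T) (F : Finset κ × Finset κ → M) :
    ∑ p ∈ coverPairs t (T.image v), F p = ∑ p ∈ coverPairs t T, F (p.1.image v, p.2.image v) := by
  have hsub : ∀ p ∈ coverPairs t T, p.1 ⊆ T ∧ p.2 ⊆ T := fun p hp => by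
    obtain ⟨h, -, -⟩ := mem_coverPairs.1 hp
    exact ⟨h ▸ Finset.subset_union_left, h ▸ Finset.subset_union_right⟩
  have himg : ∀ A B : Finset ι, A ⊆ T → B ⊆ T → A.image v = B.image v → A = B :=
    fun A B hA hB h => by
      have h' : v '' (A : Set ι) = v '' (B : Set ι) := by exact_mod_cast h
      exact_mod_cast (hv.image_eq_image_iff (by exact_mod_cast hA) (by exact_mod_cast hB)).1 h'
  have hcard : ∀ A ⊆ T, (A.image v).card = A.card := fun A hA =>
    Finset.card_image_of_injOn (hv.mono (by exact_mod_cast hA))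
  symm
  refine Finset.sum_bij (fun p _ => (p.1.image v, p.2.image v)) ?_ ?_ ?_ (fun _ _ => rfl)
  · intro p hp
    obtain ⟨h, h₁, h₂⟩ := mem_coverPairs.1 hp
    exact mem_coverPairs.2 ⟨by rw [← Finset.image_union, h],
      Finset.card_image_le.trans h₁, Finset.card_image_le.trans h₂⟩
  · intro p hp r hr h
    simp only [Prod.mk.injEq] at h
    exact Prod.ext (himg _ _ (hsub p hp).1 (hsub r hr).1 h.1)
      (himg _ _ (hsub p hp).2 (hsub r hr).2 h.2)
  · rintro ⟨A, B⟩ hp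
    obtain ⟨h, h₁, h₂⟩ := mem_coverPairs.1 hp
    simp only at h h₁ h₂
    obtain ⟨A', hA', rfl⟩ := Finset.subset_image_iff.1
      (show A ⊆ T.image v from h ▸ Finset.subset_union_left)
    obtain ⟨B', hB', rfl⟩ := Finset.subset_image_iff.1
      (show B ⊆ T.image v from h ▸ Finset.subset_union_right)
    replace hA' : A' ⊆ T := by exact_mod_cast hA'
    replace hB' : B' ⊆ T := by exact_mod_cast hB'
    refine ⟨(A', B'), mem_coverPairs.2 ⟨himg _ _ (Finset.union_subset hA' hB') subset_rfl ?_, ?_, ?_⟩,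
      rfl⟩
    · rw [← h, Finset.image_union]
    · rwa [hcard A' hA'] at h₁
    · rwa [hcard B' hB'] at h₂

/-- Each pair of small subsets of `R` is counted once, at its union. -/
theorem sum_powerset_sum_coverPairs {ι M : Type*} [DecidableEq ι] [AddCommMonoid M] (t : ℕ)
    (R : Finset ι) (F : Finset ι × Finset ι → M) :
    ∑ Q ∈ R.powerset, ∑ p ∈ coverPairs t Q, F p =
      ∑ p ∈ {A ∈ R.powerset | A.card ≤ t} ×ˢ {A ∈ R.powerset | A.card ≤ t}, F p := by
  symm
  rw [← Finset.sum_fiberwise_of_maps_to (t := R.powerset)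
    (g := fun p : Finset ι × Finset ι => p.1 ∪ p.2)]
  · symm
    refine Finset.sum_congr rfl fun Q hQ => Finset.sum_congr ?_ fun _ _ => rfl
    ext p
    simp only [mem_coverPairs, Finset.mem_filter, Finset.mem_product, Finset.mem_powerset] at hQ ⊢
    constructor
    · rintro ⟨rfl, h₁, h₂⟩
      exact ⟨⟨⟨Finset.subset_union_left.trans hQ, h₁⟩, ⟨Finset.subset_union_right.trans hQ, h₂⟩⟩,
        rfl⟩
    · rintro ⟨⟨⟨-, h₁⟩, ⟨-, h₂⟩⟩, h⟩
      exact ⟨h, h₁, h₂⟩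
  · intro p hp
    simp only [Finset.mem_filter, Finset.mem_product, Finset.mem_powerset] at hp ⊢
    exact Finset.union_subset hp.1.1 hp.2.1

/-- Newton's forward difference formula: f(k) is the k-th difference of `g` at 0, and a set of size
n has n choose k subsets of size k. -/
theorem exists_forall_sum_powerset_card_eq (g : ℕ → ℝ) :
    ∃ f : ℕ → ℝ, ∀ {ι : Type*} (R : Finset ι), ∑ Q ∈ R.powerset, f Q.card = g R.card := by
  refine ⟨fun k => (fwdDiff 1)^[k] g 0, fun R => ?_⟩
  rw [Finset.sum_powerset_apply_card (fun k => (fwdDiff 1)^[k] g 0)]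
  simpa using (shift_eq_sum_fwdDiff_iter 1 g R.card 0).symm

/-- If the sums of `f` over the subsets of a set with `n ≤ a` elements square to `a - n`, then the
sum of `f |J| f |J'|` over all `J ∪ J' = S` is the Möbius inverse of `a - |S|`. -/
theorem sum_coverPairs_mul_eq {ι : Type*} [DecidableEq ι] {a t : ℕ} (hat : a ≤ t) {f : ℕ → ℝ}
    (hf : ∀ R : Finset ι, R.card ≤ a → (∑ Q ∈ R.powerset, f Q.card) ^ 2 = a - R.card)
    (S : Finset ι) (hS : S.card ≤ a) :
    ∑ p ∈ coverPairs t S, f p.1.card * f p.2.card =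
      if S.card = 0 then (a : ℝ) else if S.card = 1 then -1 else 0 := by
  set h : ℕ → ℝ := fun n => if n = 0 then (a : ℝ) else if n = 1 then -1 else 0 with hh
  have hsum : ∀ R : Finset ι, ∑ Q ∈ R.powerset, h Q.card = a - R.card := fun R => by
    rw [Finset.sum_powerset_apply_card h, Finset.sum_range_succ']
    rcases hn : R.card with _ | n
    · simp [hh]
    · rw [Finset.sum_range_succ']
      simp [hh]
      ring
  have hF : ∀ R : Finset ι, R.card ≤ a →
      ∑ Q ∈ R.powerset, ∑ p ∈ coverPairs t Q, f p.1.card * f p.2.card = a - R.card := fun R hR => by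
    rw [sum_powerset_sum_coverPairs t R (fun p => f p.1.card * f p.2.card), ← hf R hR, sq,
      Finset.sum_mul_sum, Finset.sum_product]
    -- Here a ≤ t is essential: the size bound on the pairs excludes nothing, so the square is
    -- complete.
    have : ({A ∈ R.powerset | A.card ≤ t} : Finset (Finset ι)) = R.powerset :=
      Finset.filter_true_of_mem fun A hA =>
        (Finset.card_le_card (Finset.mem_powerset.1 hA)).trans (hR.trans hat)
    rw [this]
  change _ = h S.card
  -- Möbius inversion: both functions have the same sums over all subsets, so they agree at `S` once
  -- they agree on its proper subsets.
  induction S using Finset.strongInduction with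
  | H S ih =>
    have h₁ := hF S hS
    have h₂ := hsum S
    rw [← Finset.insert_erase (Finset.mem_powerset_self S),
      Finset.sum_insert (Finset.notMem_erase _ _)] at h₁ h₂
    have h₃ : ∑ Q ∈ S.powerset.erase S, ∑ p ∈ coverPairs t Q, f p.1.card * f p.2.card =
        ∑ Q ∈ S.powerset.erase S, h Q.card := Finset.sum_congr rfl fun Q hQ => by
      have hQ' := Finset.mem_ssubsets.1 hQ
      exact ih Q hQ' ((Finset.card_le_card hQ'.1).trans hS)
    linarith

section

/-! ### The topology of the spaces of independent sets -/

variable {V : Type*} {G : SimpleGraph V}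

theorem toSubsetsLE_inl_val (n : ℕ) (v : Fin n → V) :
    (toSubsetsLE V n (Sum.inl v)).1 = Finset.univ.image v := rfl

theorem toSubsetsLE_inr_val (n : ℕ) (u : Unit) : (toSubsetsLE V n (Sum.inr u)).1 = ∅ := rfl

theorem exists_image_univ_eq {ι : Type*} [DecidableEq ι] {n : ℕ} {A : Finset ι}
    (hA : A.Nonempty) (hn : A.card ≤ n) : ∃ s : Fin n → ι, Finset.univ.image s = A := by
  obtain ⟨a, ha⟩ := hA
  have : Nonempty A := ⟨⟨a, ha⟩⟩
  obtain ⟨e⟩ : Nonempty (A ↪ Fin n) :=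
    Function.Embedding.nonempty_of_card_le (by simpa using hn)
  refine ⟨fun i => (Function.invFun e i : A), ?_⟩
  ext x
  simp only [Finset.mem_image, Finset.mem_univ, true_and]
  constructor
  · rintro ⟨i, rfl⟩
    exact (Function.invFun e i).2
  · intro hx
    exact ⟨e ⟨x, hx⟩, by rw [Function.leftInverse_invFun e.injective]⟩

theorem isIndepSet_of_subset {s t : Set V} (ht : G.IsIndepSet t) (h : s ⊆ t) : G.IsIndepSet s :=
  Set.Pairwise.mono h ht

namespace IndepSets

theorem card_le {n : ℕ} (S : IndepSets G n) : S.toFinset.card ≤ n := S.1.2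

theorem isIndepSet {n : ℕ} (S : IndepSets G n) : G.IsIndepSet (S.toFinset : Set V) := S.2

theorem toFinset_injective {n : ℕ} :
    Function.Injective (toFinset : IndepSets G n → Finset V) :=
  fun _ _ h => Subtype.ext (Subtype.ext h)

variable (G) in
open Classical in
/-- The point of `I_t` given by a finite set, and `∅` if that set is not in `I_t`. -/
def ofFinset (t : ℕ) (A : Finset V) : IndepSets G t :=
  if h : A.card ≤ t ∧ G.IsIndepSet (A : Set V) then ⟨⟨A, h.1⟩, h.2⟩
  else ⟨⟨∅, by simp⟩, by simp [SimpleGraph.IsIndepSet]⟩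

theorem toFinset_ofFinset {t : ℕ} {A : Finset V} (h : A.card ≤ t)
    (hA : G.IsIndepSet (A : Set V)) : (ofFinset G t A).toFinset = A := by
  rw [ofFinset, dif_pos ⟨h, hA⟩]
  rfl

theorem toFinset_ofFinset_of_lt {t : ℕ} {A : Finset V} (h : t < A.card) :
    (ofFinset G t A).toFinset = ∅ := by
  rw [ofFinset, dif_neg (fun h' => absurd h'.1 (by omega))]
  rfl

@[simp]
theorem ofFinset_toFinset {t : ℕ} (S : IndepSets G t) : ofFinset G t S.toFinset = S :=
  toFinset_injective (toFinset_ofFinset S.card_le S.isIndepSet)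

end IndepSets

open IndepSets

variable (G) in
/-- The tuples of vertices whose entries form an independent set. -/
abbrev IndepTuples (n : ℕ) : Type _ := {v : Fin n → V // G.IsIndepSet (Set.range v)}

theorem isIndepSet_image {n : ℕ} (v : IndepTuples G n) (A : Finset (Fin n)) :
    G.IsIndepSet (A.image v.1 : Set V) :=
  isIndepSet_of_subset v.2 (by simp)

/-- The quotient map onto `I_n`, with the extra isolated point. -/
def tupleToIndepSet (n : ℕ) : IndepTuples G n ⊕ Unit → IndepSets G n :=
  Sum.elim
    (fun v => ⟨toSubsetsLE V n (Sum.inl v.1), by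
      rw [toSubsetsLE_inl_val]; exact isIndepSet_image v _⟩)
    (fun u => ⟨toSubsetsLE V n (Sum.inr u), by
      rw [toSubsetsLE_inr_val]; simp [SimpleGraph.IsIndepSet]⟩)

theorem toFinset_tupleToIndepSet_inl {n : ℕ} (v : IndepTuples G n) :
    (tupleToIndepSet n (Sum.inl v)).toFinset = Finset.univ.image v.1 := rfl

theorem val_tupleToIndepSet (n : ℕ) (x : IndepTuples G n ⊕ Unit) :
    (tupleToIndepSet n x).1 = toSubsetsLE V n (Sum.map Subtype.val id x) := by
  rcases x with v | u <;> rfl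

theorem tupleToIndepSet_surjective (n : ℕ) :
    Function.Surjective (tupleToIndepSet (G := G) n) := by
  intro S
  rcases S.toFinset.eq_empty_or_nonempty with h | h
  · exact ⟨Sum.inr (), toFinset_injective h.symm⟩
  · obtain ⟨v, hv⟩ := exists_image_univ_eq h S.card_le
    refine ⟨Sum.inl ⟨v, ?_⟩, toFinset_injective hv⟩
    have := S.isIndepSet
    rw [← hv] at this
    simpa using this

variable [TopologicalSpace V]

theorem continuous_toSubsetsLE (n : ℕ) : Continuous (toSubsetsLE V n) :=
  continuous_coinduced_rng

/-- The saturation of a closed set of tuples is the projection, along a compact factor, of a closed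
set of pairs of tuples with equal range. -/
theorem isClosedMap_toSubsetsLE [T2Space V] [CompactSpace V] (n : ℕ) :
    IsClosedMap (toSubsetsLE V n) := by
  intro C hC
  refine isClosed_coinduced.2 (isClosed_sum_iff.2 ⟨?_, isClosed_discrete _⟩)
  -- For n = 0 the empty tuple and the extra point have the same image, so this case is separate.
  rcases Nat.eq_zero_or_pos n with rfl | hn
  · exact (Set.toFinite _).isClosed
  have hR : IsClosed {p : (Fin n → V) × (Fin n → V) | Set.range p.1 = Set.range p.2} := by
    have : {p : (Fin n → V) × (Fin n → V) | Set.range p.1 = Set.range p.2} =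
        (⋂ i, ⋃ j, {p | p.1 i = p.2 j}) ∩ (⋂ i, ⋃ j, {p | p.2 i = p.1 j}) := by
      ext p
      simp [Set.Subset.antisymm_iff, Set.range_subset_iff, eq_comm]
    rw [this]
    refine IsClosed.inter (isClosed_iInter fun i => isClosed_iUnion_of_finite fun j => ?_)
      (isClosed_iInter fun i => isClosed_iUnion_of_finite fun j => ?_)
    · exact isClosed_eq (by fun_prop) (by fun_prop)
    · exact isClosed_eq (by fun_prop) (by fun_prop)
  have hCl := isClosedMap_snd_of_compactSpace (X := Fin n → V) (Y := Fin n → V) _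
    (hR.inter ((hC.preimage continuous_inl).preimage continuous_fst))
  convert hCl using 1
  ext v
  simp only [Set.mem_preimage, Set.mem_image, Set.mem_inter_iff, Set.mem_ofPred_eq, Prod.exists,
    exists_eq_right]
  constructor
  · rintro ⟨w | u, hw, h⟩
    · refine ⟨w, ?_, hw⟩
      have := congrArg (fun S : SubsetsLE V n => (S.1 : Set V)) h
      simpa [toSubsetsLE_inl_val] using this
    · exfalso
      have := congrArg (fun S : SubsetsLE V n => S.1) h
      simp only [toSubsetsLE_inl_val, toSubsetsLE_inr_val] at this
      have : v ⟨0, hn⟩ ∈ (∅ : Finset V) := by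
        rw [this]; exact Finset.mem_image_of_mem _ (Finset.mem_univ _)
      simp at this
  · rintro ⟨w, h, hw⟩
    refine ⟨Sum.inl w, hw, Subtype.ext (Finset.coe_injective ?_)⟩
    simpa [toSubsetsLE_inl_val] using h

theorem IsTopologicalPackingGraph.exists_isOpen_isClique (hG : IsTopologicalPackingGraph G)
    (x : V) : ∃ U : Set V, IsOpen U ∧ x ∈ U ∧ G.IsClique U := by
  obtain ⟨U, hU, hx, hc⟩ := hG {x} (by simp)
  exact ⟨U, hU, hx (by simp), hc⟩

/-- An open clique around both ends makes all nearby pairs off the closed diagonal adjacent. -/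
theorem IsTopologicalPackingGraph.isOpen_adj [T2Space V] (hG : IsTopologicalPackingGraph G) :
    IsOpen {p : V × V | G.Adj p.1 p.2} := by
  refine isOpen_iff_mem_nhds.2 fun p hp => ?_
  obtain ⟨U, hU, hpU, hc⟩ := hG {p.1, p.2} (by
    simpa [SimpleGraph.isClique_pair] using fun _ => hp)
  have h₁ : p.1 ∈ U := hpU (by simp)
  have h₂ : p.2 ∈ U := hpU (by simp)
  have hne : p.1 ≠ p.2 := G.ne_of_adj hp
  filter_upwards [(hU.prod hU).mem_nhds ⟨h₁, h₂⟩,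
    (isClosed_diagonal (X := V)).isOpen_compl.mem_nhds (x := p) hne] with r hr hr'
  exact hc hr.1 hr.2 hr'

theorem IsTopologicalPackingGraph.isClosed_indepTuples [T2Space V]
    (hG : IsTopologicalPackingGraph G) (n : ℕ) :
    IsClosed {v : Fin n → V | G.IsIndepSet (Set.range v)} := by
  have : {v : Fin n → V | G.IsIndepSet (Set.range v)} =
      ⋂ i, ⋂ j, {v | ¬ G.Adj (v i) (v j)} := by
    ext v
    simp only [Set.mem_ofPred_eq, Set.mem_iInter, SimpleGraph.IsIndepSet]
    constructor
    · intro h i j hij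
      exact h ⟨i, rfl⟩ ⟨j, rfl⟩ (G.ne_of_adj hij) hij
    · rintro h _ ⟨i, rfl⟩ _ ⟨j, rfl⟩ -
      exact h i j
  rw [this]
  refine isClosed_iInter fun i => isClosed_iInter fun j => ?_
  exact (hG.isOpen_adj.isClosed_compl).preimage (f := fun v : Fin n → V => (v i, v j))
    (by fun_prop)

theorem continuous_tupleToIndepSet (n : ℕ) : Continuous (tupleToIndepSet (G := G) n) := by
  refine Continuous.subtype_mk (f := fun x => toSubsetsLE V n (Sum.map Subtype.val id x)) ?_ ?_
    |>.congr fun x => Subtype.ext (val_tupleToIndepSet n x).symm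
  · exact (continuous_toSubsetsLE n).comp (continuous_subtype_val.sumMap continuous_id)
  · intro x
    rw [← val_tupleToIndepSet]
    exact (tupleToIndepSet n x).2

theorem unionSum_eq_sum_coverPairs (t : ℕ) (K : C(IndepSets G t × IndepSets G t, ℝ))
    (S : IndepSets G (2 * t)) :
    unionSum G t K S =
      ∑ p ∈ coverPairs t S.toFinset, K (ofFinset G t p.1, ofFinset G t p.2) := by
  refine Finset.sum_bij (fun p _ => (p.1.toFinset, p.2.toFinset)) ?_ ?_ ?_ ?_
  · intro p hp
    exact mem_coverPairs.2 ⟨(unionPairs_finite G t S).mem_toFinset.1 hp, p.1.card_le, p.2.card_le⟩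
  · intro p _ r _ h
    simp only [Prod.mk.injEq] at h
    exact Prod.ext (toFinset_injective h.1) (toFinset_injective h.2)
  · rintro ⟨A, B⟩ hp
    obtain ⟨h, hA, hB⟩ := mem_coverPairs.1 hp
    have hA' : (ofFinset G t A).toFinset = A := toFinset_ofFinset hA
      (isIndepSet_of_subset S.isIndepSet (by rw [← h]; simp))
    have hB' : (ofFinset G t B).toFinset = B := toFinset_ofFinset hB
      (isIndepSet_of_subset S.isIndepSet (by rw [← h]; simp))
    refine ⟨(ofFinset G t A, ofFinset G t B), (unionPairs_finite G t S).mem_toFinset.2 ?_, ?_⟩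
    · change (ofFinset G t A).toFinset ∪ (ofFinset G t B).toFinset = S.toFinset
      rw [hA', hB']
      exact h
    · rw [hA', hB']
  · intro p _
    simp

theorem continuous_ofFinset_image {n t : ℕ} {A : Finset (Fin n)} (hA : A.card ≤ t) :
    Continuous fun v : IndepTuples G n => ofFinset G t (A.image v.1) := by
  rcases A.eq_empty_or_nonempty with rfl | hne
  · simpa using continuous_const
  obtain ⟨s, hs⟩ := exists_image_univ_eq hne hA
  have h : Continuous fun v : IndepTuples G n => tupleToIndepSet (G := G) t
      (Sum.inl ⟨v.1 ∘ s, isIndepSet_of_subset v.2 (Set.range_comp_subset_range s v.1)⟩) :=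
    (continuous_tupleToIndepSet t).comp (continuous_inl.comp (Continuous.subtype_mk
      ((Pi.continuous_precomp s).comp continuous_subtype_val) _))
  refine h.congr fun v => toFinset_injective ?_
  rw [toFinset_ofFinset (Finset.card_image_le.trans hA) (isIndepSet_image v A),
    toFinset_tupleToIndepSet_inl, ← hs, Finset.image_image]

/-- Locally, the equality pattern of an independent tuple is constant. -/
theorem IsTopologicalPackingGraph.exists_eventually_injOn [T2Space V]
    (hG : IsTopologicalPackingGraph G) {n : ℕ} (v₀ : IndepTuples G n) :
    ∃ T : Finset (Fin n), ∀ᶠ v : IndepTuples G n in 𝓝 v₀,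
      Set.InjOn v.1 T ∧ Finset.univ.image v.1 = T.image v.1 := by
  have hpat : ∀ᶠ v : IndepTuples G n in 𝓝 v₀, ∀ i j, v.1 i = v.1 j ↔ v₀.1 i = v₀.1 j := by
    refine eventually_all.2 fun i => eventually_all.2 fun j => ?_
    have hi : Continuous fun v : IndepTuples G n => v.1 i :=
      (continuous_apply i).comp continuous_subtype_val
    have hj : Continuous fun v : IndepTuples G n => v.1 j :=
      (continuous_apply j).comp continuous_subtype_val
    by_cases h : v₀.1 i = v₀.1 j
    -- Two entries of an independent tuple lying in one clique must coincide.
    · obtain ⟨U, hU, hx, hc⟩ := hG.exists_isOpen_isClique (v₀.1 i)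
      filter_upwards [hi.continuousAt.preimage_mem_nhds (hU.mem_nhds hx),
        hj.continuousAt.preimage_mem_nhds (hU.mem_nhds (h ▸ hx))] with v h₁ h₂
      refine iff_of_true ?_ h
      by_contra hne
      exact v.2 ⟨i, rfl⟩ ⟨j, rfl⟩ hne (hc h₁ h₂ hne)
    · filter_upwards [(isOpen_ne_fun hi hj).mem_nhds h] with v hv
      exact iff_of_false hv h
  -- `T` selects one index for each value of `v₀`.
  obtain ⟨T, -, hinj, himg⟩ := Finset.exists_subset_injOn_image_eq_of_surjOn (f := v₀.1)
    Set.univ (Finset.univ.image v₀.1) (by intro x; simp)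
  refine ⟨T, hpat.mono fun v hv => ⟨fun i hi j hj h => hinj hi hj ((hv i j).1 h), ?_⟩⟩
  refine subset_antisymm (fun x hx => ?_) (Finset.image_subset_image (Finset.subset_univ T))
  obtain ⟨i, -, rfl⟩ := Finset.mem_image.1 hx
  have : v₀.1 i ∈ T.image v₀.1 := himg ▸ Finset.mem_image_of_mem _ (Finset.mem_univ i)
  obtain ⟨j, hj, hij⟩ := Finset.mem_image.1 this
  exact Finset.mem_image.2 ⟨j, hj, (hv j i).2 hij⟩

variable [T2Space V] [CompactSpace V]

/-- A quotient map need not restrict to a quotient map on a subspace; closedness of the map and of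
the set of independent tuples supplies this. -/
theorem IsTopologicalPackingGraph.isQuotientMap_tupleToIndepSet
    (hG : IsTopologicalPackingGraph G) (n : ℕ) :
    IsQuotientMap (tupleToIndepSet (G := G) n) := by
  refine IsClosedMap.isQuotientMap ?_ (continuous_tupleToIndepSet n) (tupleToIndepSet_surjective n)
  intro C hC
  have hemb : IsClosedMap (Sum.map Subtype.val id : IndepTuples G n ⊕ Unit → _) :=
    (hG.isClosed_indepTuples n).isClosedEmbedding_subtypeVal.isClosedMap.sumMap IsClosedMap.id
  have hcl : IsClosed (Subtype.val '' (tupleToIndepSet n '' C)) := by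
    convert isClosedMap_toSubsetsLE n _ (hemb _ hC) using 1
    rw [← Set.image_comp, ← Set.image_comp]
    exact Set.image_congr fun x _ => val_tupleToIndepSet n x
  rw [← Set.preimage_image_eq (tupleToIndepSet n '' C) Subtype.val_injective]
  exact hcl.preimage continuous_subtype_val

theorem IsTopologicalPackingGraph.compactSpace_indepSets (hG : IsTopologicalPackingGraph G)
    (n : ℕ) : CompactSpace (IndepSets G n) := by
  have : CompactSpace (IndepTuples G n) :=
    isCompact_iff_compactSpace.1 (hG.isClosed_indepTuples n).isCompact
  exact (tupleToIndepSet_surjective n).compactSpace (continuous_tupleToIndepSet n)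

theorem IsTopologicalPackingGraph.continuous_indepSets_iff (hG : IsTopologicalPackingGraph G)
    {n : ℕ} {Z : Type*} [TopologicalSpace Z] {f : IndepSets G n → Z} :
    Continuous f ↔ Continuous fun v : IndepTuples G n => f (tupleToIndepSet n (Sum.inl v)) := by
  rw [(hG.isQuotientMap_tupleToIndepSet n).continuous_iff, continuous_sum_dom]
  exact and_iff_left continuous_of_discreteTopology

theorem IsTopologicalPackingGraph.continuous_card (hG : IsTopologicalPackingGraph G) (n : ℕ) :
    Continuous fun S : IndepSets G n => S.toFinset.card := by
  refine hG.continuous_indepSets_iff.2 (continuous_iff_continuousAt.2 fun v₀ => ?_)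
  obtain ⟨T, hT⟩ := hG.exists_eventually_injOn v₀
  refine (continuousAt_const (y := T.card)).congr (hT.mono fun v hv => ?_)
  beta_reduce
  rw [toFinset_tupleToIndepSet_inl, hv.2, Finset.card_image_of_injOn hv.1]

/-- The jump to the default value ∅ above size t does no harm, as cardinality is locally constant.
-/
theorem IsTopologicalPackingGraph.continuous_ofFinset_toFinset (hG : IsTopologicalPackingGraph G)
    (n t : ℕ) : Continuous fun S : IndepSets G n => ofFinset G t S.toFinset := by
  refine hG.continuous_indepSets_iff.2 (continuous_iff_continuousAt.2 fun v₀ => ?_)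
  obtain ⟨T, hT⟩ := hG.exists_eventually_injOn v₀
  rcases le_or_gt T.card t with h | h
  · refine (continuous_ofFinset_image h).continuousAt.congr (hT.mono fun v hv => ?_)
    beta_reduce
    rw [toFinset_tupleToIndepSet_inl, hv.2]
  · refine (continuousAt_const (y := ofFinset G t ∅)).congr (hT.mono fun v hv => ?_)
    beta_reduce
    refine toFinset_injective ?_
    rw [toFinset_tupleToIndepSet_inl, hv.2, toFinset_ofFinset_of_lt (A := T.image v.1),
      toFinset_ofFinset (by simp) (by simp [SimpleGraph.IsIndepSet])]
    rwa [Finset.card_image_of_injOn hv.1]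

theorem IsTopologicalPackingGraph.continuous_unionSum (hG : IsTopologicalPackingGraph G) (t : ℕ)
    (K : C(IndepSets G t × IndepSets G t, ℝ)) : Continuous (unionSum G t K) := by
  refine hG.continuous_indepSets_iff.2 (continuous_iff_continuousAt.2 fun v₀ => ?_)
  obtain ⟨T, hT⟩ := hG.exists_eventually_injOn v₀
  have hc : Continuous fun v : IndepTuples G (2 * t) => ∑ p ∈ coverPairs t T,
      K (ofFinset G t (p.1.image v.1), ofFinset G t (p.2.image v.1)) := by
    refine continuous_finsetSum _ fun p hp => K.continuous.comp ?_
    obtain ⟨-, h₁, h₂⟩ := mem_coverPairs.1 hp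
    exact (continuous_ofFinset_image h₁).prodMk (continuous_ofFinset_image h₂)
  refine hc.continuousAt.congr (hT.mono fun v hv => ?_)
  beta_reduce
  rw [unionSum_eq_sum_coverPairs, toFinset_tupleToIndepSet_inl, hv.2,
    sum_coverPairs_image t hv.1 fun p => K (ofFinset G t p.1, ofFinset G t p.2)]

end

/-! ### Finiteness of the independence number -/

open IndepSets

variable {V : Type*} {G : SimpleGraph V} [TopologicalSpace V]

/-- Finitely many open cliques cover `V`, and an independent set meets each in at most one point. -/
theorem IsTopologicalPackingGraph.bddAbove_indepSets [CompactSpace V]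
    (hG : IsTopologicalPackingGraph G) : BddAbove {n : ℕ | ∃ s : Finset V, G.IsNIndepSet n s} := by
  choose U hU hxU hc using hG.exists_isOpen_isClique
  obtain ⟨F, hF⟩ := CompactSpace.elim_nhds_subcover U fun x => (hU x).mem_nhds (hxU x)
  have hcov : ∀ x, ∃ y ∈ F, x ∈ U y := fun x => by
    have : x ∈ ⋃ y ∈ F, U y := hF ▸ Set.mem_univ x
    simpa using this
  choose c hcF hcU using hcov
  refine ⟨F.card, ?_⟩
  rintro _ ⟨s, hs, rfl⟩
  refine Finset.card_le_card_of_injOn c (fun x _ => hcF x) fun x hx y hy hxy => ?_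
  by_contra hne
  exact hs hx hy hne (hc (c x) (hcU x) (hxy ▸ hcU y) hne)

theorem IsTopologicalPackingGraph.isGreatest_indepNum [CompactSpace V]
    (hG : IsTopologicalPackingGraph G) :
    IsGreatest {n : ℕ | ∃ s : Finset V, G.IsNIndepSet n s} G.indepNum :=
  ⟨Nat.sSup_mem ⟨0, ∅, by simp [SimpleGraph.isNIndepSet_iff]⟩ hG.bddAbove_indepSets,
    fun _ hn => le_csSup hG.bddAbove_indepSets hn⟩

theorem IsTopologicalPackingGraph.card_le_indepNum [CompactSpace V]
    (hG : IsTopologicalPackingGraph G) {n : ℕ}    (S : IndepSets G n) : S.toFinset.card ≤ G.indepNum :=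
  hG.isGreatest_indepNum.2 ⟨S.toFinset, S.isIndepSet, rfl⟩

variable [T2Space V] [CompactSpace V]

theorem IsTopologicalPackingGraph.measurable_card (hG : IsTopologicalPackingGraph G) (n : ℕ) :
    Measurable fun S : IndepSets G n => S.toFinset.card :=
  (hG.continuous_card n).measurable

theorem IsTopologicalPackingGraph.measurableSet_card_eq (hG : IsTopologicalPackingGraph G)
    (n k : ℕ) : MeasurableSet {S : IndepSets G n | S.toFinset.card = k} :=
  hG.measurable_card n (measurableSet_singleton k)

theorem IsFeasible.isFiniteMeasure (hG : IsTopologicalPackingGraph G) {t : ℕ}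
    {ν : Measure (IndepSets G (2 * t))} (hν : IsFeasible G t ν) : IsFiniteMeasure ν :=
  haveI := hG.compactSpace_indepSets (2 * t)
  haveI := hν.locallyFinite
  inferInstance

/-! ### The upper bound from the independence number on -/

theorem IsFeasible.measure_indepSetsOfCard_one_le (hG : IsTopologicalPackingGraph G) {t : ℕ}
    (ht : G.indepNum ≤ t) {ν : Measure (IndepSets G (2 * t))} (hν : IsFeasible G t ν) :
    ν (indepSetsOfCard G (2 * t) 1) ≤ G.indepNum := by
  have := hν.isFiniteMeasure hG
  -- The square root is genuine for every independent set, since its size is at most α.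
  obtain ⟨f, hf⟩ := exists_forall_sum_powerset_card_eq
    fun n => Real.sqrt ((G.indepNum : ℝ) - n)
  have hcard : Continuous fun S : IndepSets G t => f S.toFinset.card :=
    continuous_of_discreteTopology.comp (hG.continuous_card t)
  let K : C(IndepSets G t × IndepSets G t, ℝ) :=
    ⟨fun p => f p.1.toFinset.card * f p.2.toFinset.card,
      (hcard.comp continuous_fst).mul (hcard.comp continuous_snd)⟩
  have hK : IsPosDefKernel K :=
    ⟨fun x y => mul_comm _ _, fun m x => by
      have h := Matrix.posSemidef_vecMulVec_self_star fun i => f (x i).toFinset.card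
      rwa [star_trivial] at h⟩
  have hsum : ∀ S, unionSum G t K S =
      {S : IndepSets G (2 * t) | S.toFinset.card = 0}.indicator (fun _ => (G.indepNum : ℝ)) S -
        (indepSetsOfCard G (2 * t) 1).indicator (fun _ => 1) S := fun S => by
    have hS := hG.card_le_indepNum S
    rw [unionSum_eq_sum_coverPairs]
    trans ∑ p ∈ coverPairs t S.toFinset, f p.1.card * f p.2.card
    · refine Finset.sum_congr rfl fun p hp => ?_
      obtain ⟨h, h₁, h₂⟩ := mem_coverPairs.1 hp
      change f (ofFinset G t p.1).toFinset.card * f (ofFinset G t p.2).toFinset.card = _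
      rw [toFinset_ofFinset h₁ (isIndepSet_of_subset S.isIndepSet (by rw [← h]; simp)),
        toFinset_ofFinset h₂ (isIndepSet_of_subset S.isIndepSet (by rw [← h]; simp))]
    · rw [sum_coverPairs_mul_eq ht (fun R hR => ?_) S.toFinset hS]
      · simp only [Set.indicator, indepSetsOfCard, Set.mem_ofPred_eq]
        split_ifs <;> simp_all
      · rw [hf R, Real.sq_sqrt (sub_nonneg.2 (by exact_mod_cast hR))]
  have h0 := hν.posDef K hK
  have hm0 := hG.measurableSet_card_eq (2 * t) 0
  have hm1 : MeasurableSet (indepSetsOfCard G (2 * t) 1) := hG.measurableSet_card_eq (2 * t) 1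
  have hν0 : ν.real {S : IndepSets G (2 * t) | S.toFinset.card = 0} = 1 := by
    simp [measureReal_def, hν.normalized]
  rw [adjointPairing, integral_congr_ae (ae_of_all _ hsum),
    integral_sub ((integrable_const _).indicator hm0) ((integrable_const _).indicator hm1),
    integral_indicator_const _ hm0, integral_indicator_const _ hm1, hν0] at h0
  have h1 : ν.real (indepSetsOfCard G (2 * t) 1) ≤ G.indepNum := by
    simpa using h0
  rw [← ENNReal.ofReal_natCast, ← ofReal_measureReal]
  exact ENNReal.ofReal_le_ofReal h1

theorem las_le_indepNum (hG : IsTopologicalPackingGraph G) {t : ℕ} (ht : G.indepNum ≤ t) :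
    las G t ≤ G.indepNum :=
  iSup₂_le fun _ hν => hν.measure_indepSetsOfCard_one_le hG ht

/-! ### The lower bound from a maximum independent set -/

/-- The quadratic form evaluated at the all-ones vector. -/
theorem IsPosDefKernel.sum_product_nonneg {X ι : Type*} [TopologicalSpace X] {K : C(X × X, ℝ)}
    (hK : IsPosDefKernel K) (s : Finset ι) (x : ι → X) :
    0 ≤ ∑ p ∈ s ×ˢ s, K (x p.1, x p.2) := by
  have h := (hK.posSemidef s.card fun i => x (s.equivFin.symm i)).dotProduct_mulVec_nonneg
    (fun _ => 1)
  simp only [dotProduct, Matrix.mulVec, Matrix.of_apply, Pi.star_apply, star_one, one_mul,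
    mul_one] at h
  rw [Finset.sum_product, ← Finset.sum_coe_sort s]
  simp_rw [← Finset.sum_coe_sort s]
  rw [← s.equivFin.symm.sum_comp]
  simp_rw [← s.equivFin.symm.sum_comp fun j : s => K (x _, x j)]
  exact h

theorem innerRegular_dirac {X : Type*} [TopologicalSpace X] [MeasurableSpace X] (a : X) :
    (Measure.dirac a).InnerRegular := by
  refine ⟨fun U hU r hr => ?_⟩
  by_cases ha : a ∈ U
  · refine ⟨{a}, by simpa using ha, isCompact_singleton, ?_⟩
    rwa [Measure.dirac_apply_of_mem (Set.mem_singleton a), ← Measure.dirac_apply_of_mem ha]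
  · rw [Measure.dirac_apply' a hU, Set.indicator_of_notMem ha] at hr
    exact absurd hr not_lt_zero

theorem indepNum_le_las (hG : IsTopologicalPackingGraph G) {t : ℕ} (ht : 1 ≤ t) :
    (G.indepNum : ℝ≥0∞) ≤ las G t := by
  obtain ⟨R, hR, hRc⟩ := hG.isGreatest_indepNum.1
  let P : Finset (Finset V) := {Q ∈ R.powerset | Q.card ≤ 2 * t}
  let ν : Measure (IndepSets G (2 * t)) := ∑ Q ∈ P, Measure.dirac (ofFinset G (2 * t) Q)
  have hP : ∀ Q ∈ P, (ofFinset G (2 * t) Q).toFinset = Q := fun Q hQ => by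
    obtain ⟨h₁, h₂⟩ := Finset.mem_filter.1 hQ
    exact toFinset_ofFinset h₂
      (isIndepSet_of_subset hR (by exact_mod_cast Finset.mem_powerset.1 h₁))
  have hcard : ∀ k, ν {S | S.toFinset.card = k} = ({Q ∈ P | Q.card = k}.card : ℝ≥0∞) := fun k => by
    rw [Measure.finsetSum_apply, Finset.card_filter]
    push_cast
    refine Finset.sum_congr rfl fun Q hQ => ?_
    rw [Measure.dirac_apply' _ (hG.measurableSet_card_eq _ k)]
    simp [Set.indicator, hP Q hQ]
  have hν : IsFeasible G t ν := by
    have := fun a : IndepSets G (2 * t) => innerRegular_dirac a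
    refine ⟨inferInstance, inferInstance, ?_, fun K hK => ?_⟩
    · have h := hcard 0
      simp only [Finset.card_eq_zero] at h
      rw [h, Finset.filter_eq', if_pos (by simp [P])]
      simp
    · have hsum : adjointPairing G t ν K =
          ∑ Q ∈ R.powerset, ∑ p ∈ coverPairs t Q, K (ofFinset G t p.1, ofFinset G t p.2) := by
        have hc := hG.continuous_unionSum t K
        rw [adjointPairing, integral_finsetSum_measure
          fun Q _ => integrable_dirac' hc.stronglyMeasurable (by simp),
          -- Sets with more than 2t elements are no union of two admissible sets, so adding them to
          -- the sum changes nothing.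
          ← Finset.sum_filter_of_ne (s := R.powerset) (p := fun Q => Q.card ≤ 2 * t)]
        · refine Finset.sum_congr rfl fun Q hQ => ?_
          rw [integral_dirac' _ _ hc.stronglyMeasurable, unionSum_eq_sum_coverPairs, hP Q hQ]
        · intro Q _ hQ
          obtain ⟨p, hp, -⟩ := Finset.exists_ne_zero_of_sum_ne_zero hQ
          exact card_le_of_mem_coverPairs hp
      rw [hsum, sum_powerset_sum_coverPairs t R fun p => K (ofFinset G t p.1, ofFinset G t p.2)]
      exact hK.sum_product_nonneg _ _
  refine le_iSup₂_of_le ν hν ?_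
  have h : ν (indepSetsOfCard G (2 * t) 1) = _ := hcard 1
  have h1 : ({Q ∈ P | Q.card = 1} : Finset (Finset V)) = R.powersetCard 1 := by
    ext Q
    simp only [P, Finset.mem_filter, Finset.mem_powerset, Finset.mem_powersetCard]
    constructor
    · rintro ⟨⟨h, -⟩, h'⟩
      exact ⟨h, h'⟩
    · rintro ⟨h, h'⟩
      exact ⟨⟨h, by omega⟩, h'⟩
  rw [h, h1, Finset.card_powersetCard, hRc, Nat.choose_one_right]

/-! ### Monotonicity -/

/-- The extension by zero of a kernel on `I_s` to a kernel on `I_t`, for `s ≤ t`. -/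
def extendKernel (hG : IsTopologicalPackingGraph G) {s : ℕ} (t : ℕ)
    (K : C(IndepSets G s × IndepSets G s, ℝ)) : C(IndepSets G t × IndepSets G t, ℝ) where
  toFun p := (if p.1.toFinset.card ≤ s then 1 else 0) * (if p.2.toFinset.card ≤ s then 1 else 0) *
    K (ofFinset G s p.1.toFinset, ofFinset G s p.2.toFinset)
  continuous_toFun := by
    have hc : Continuous fun S : IndepSets G t => if S.toFinset.card ≤ s then (1 : ℝ) else 0 :=
      (continuous_of_discreteTopology (f := fun n : ℕ => if n ≤ s then (1 : ℝ) else 0)).comp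
        (hG.continuous_card t)
    have hr := hG.continuous_ofFinset_toFinset t s
    exact ((hc.comp continuous_fst).mul (hc.comp continuous_snd)).mul
      (K.continuous.comp ((hr.comp continuous_fst).prodMk (hr.comp continuous_snd)))

theorem isPosDefKernel_extendKernel (hG : IsTopologicalPackingGraph G) {s : ℕ} (t : ℕ)
    {K : C(IndepSets G s × IndepSets G s, ℝ)} (hK : IsPosDefKernel K) :
    IsPosDefKernel (extendKernel hG t K) := by
  refine ⟨fun x y => ?_, fun m x => ?_⟩
  · simp only [extendKernel, ContinuousMap.coe_mk, hK.symm (ofFinset G s x.toFinset)]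
    ring
  · have h := (hK.posSemidef m fun i => ofFinset G s (x i).toFinset).conjTranspose_mul_mul_same
      (Matrix.diagonal fun i => if (x i).toFinset.card ≤ s then (1 : ℝ) else 0)
    convert h using 1
    ext i j
    simp only [extendKernel, ContinuousMap.coe_mk, Matrix.of_apply, Matrix.diagonal_conjTranspose,
      Matrix.mul_diagonal, Matrix.diagonal_mul, star_trivial]
    ring

theorem unionSum_extendKernel (hG : IsTopologicalPackingGraph G) {s t : ℕ} (hst : s ≤ t)
    (K : C(IndepSets G s × IndepSets G s, ℝ)) (S : IndepSets G (2 * t)) :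
    unionSum G t (extendKernel hG t K) S =
      {S : IndepSets G (2 * t) | S.toFinset.card ≤ 2 * s}.indicator
        (fun S => unionSum G s K (ofFinset G (2 * s) S.toFinset)) S := by
  have hsub : ∀ p ∈ coverPairs t S.toFinset, (ofFinset G t p.1).toFinset = p.1 ∧
      (ofFinset G t p.2).toFinset = p.2 := fun p hp => by
    obtain ⟨h, h₁, h₂⟩ := mem_coverPairs.1 hp
    exact ⟨toFinset_ofFinset h₁ (isIndepSet_of_subset S.isIndepSet (by rw [← h]; simp)),
      toFinset_ofFinset h₂ (isIndepSet_of_subset S.isIndepSet (by rw [← h]; simp))⟩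
  have hleft : unionSum G t (extendKernel hG t K) S =
      ∑ p ∈ coverPairs s S.toFinset, K (ofFinset G s p.1, ofFinset G s p.2) := by
    have hfil : coverPairs s S.toFinset =
        {p ∈ coverPairs t S.toFinset | p.1.card ≤ s ∧ p.2.card ≤ s} := by
      ext p
      simp only [Finset.mem_filter, mem_coverPairs]
      constructor
      · rintro ⟨h, h₁, h₂⟩
        exact ⟨⟨h, h₁.trans hst, h₂.trans hst⟩, h₁, h₂⟩
      · rintro ⟨⟨h, -, -⟩, h₁, h₂⟩
        exact ⟨h, h₁, h₂⟩
    rw [unionSum_eq_sum_coverPairs, hfil, Finset.sum_filter]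
    refine Finset.sum_congr rfl fun p hp => ?_
    simp only [extendKernel, ContinuousMap.coe_mk, (hsub p hp).1, (hsub p hp).2]
    split_ifs <;> simp_all
  rw [hleft]
  by_cases hS : S.toFinset.card ≤ 2 * s
  · rw [Set.indicator_of_mem (by exact hS), unionSum_eq_sum_coverPairs,
      toFinset_ofFinset hS S.isIndepSet]
  · rw [Set.indicator_of_notMem (by exact hS)]
    exact Finset.sum_eq_zero fun p hp => absurd (card_le_of_mem_coverPairs hp) hS

theorem las_anti (hG : IsTopologicalPackingGraph G) {s t : ℕ} (hs : 1 ≤ s) (hst : s ≤ t) :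
    las G t ≤ las G s := by
  refine iSup₂_le fun ν hν => ?_
  have := hν.isFiniteMeasure hG
  have := hν.innerRegular
  -- Without this restriction `r` would send the larger sets to ∅ and spoil the normalization there.
  let B : Set (IndepSets G (2 * t)) := {S | S.toFinset.card ≤ 2 * s}
  have hB : MeasurableSet B := hG.measurable_card _ measurableSet_Iic
  let r : IndepSets G (2 * t) → IndepSets G (2 * s) := fun S => ofFinset G (2 * s) S.toFinset
  have hr : Continuous r := hG.continuous_ofFinset_toFinset _ _
  have hcard : ∀ k ≤ 2 * s, (ν.restrict B).map r {S | S.toFinset.card = k} =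
      ν {S | S.toFinset.card = k} := fun k hk => by
    rw [Measure.map_apply hr.measurable (hG.measurableSet_card_eq _ k),
      Measure.restrict_apply (hr.measurable (hG.measurableSet_card_eq _ k))]
    congr 1
    ext S
    simp only [Set.mem_inter_iff, Set.mem_preimage, Set.mem_ofPred_eq, B, r]
    constructor
    · rintro ⟨h, h'⟩
      rwa [toFinset_ofFinset h' S.isIndepSet] at h
    · intro h
      have h' : S.toFinset.card ≤ 2 * s := h.trans_le hk
      exact ⟨by rwa [toFinset_ofFinset h' S.isIndepSet], h'⟩
  have hfeas : IsFeasible G s ((ν.restrict B).map r) := by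
    refine ⟨inferInstance, Measure.InnerRegular.map_of_continuous hr, ?_, fun K hK => ?_⟩
    · have h := hcard 0 (Nat.zero_le _)
      simp only [Finset.card_eq_zero] at h
      rw [h, hν.normalized]
    · have h := hν.posDef _ (isPosDefKernel_extendKernel hG t hK)
      rw [adjointPairing, integral_congr_ae (ae_of_all _ (unionSum_extendKernel hG hst K)),
        integral_indicator hB] at h
      rwa [adjointPairing, integral_map hr.aemeasurable
        (hG.continuous_unionSum s K).aestronglyMeasurable]
  refine le_iSup₂_of_le _ hfeas ?_
  exact (hcard 1 (by omega)).ge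

end

end PackingGraph

theorem theorem2 {V : Type*} [TopologicalSpace V] [T2Space V] [CompactSpace V]
    (G : SimpleGraph V) (hG : PackingGraph.IsTopologicalPackingGraph G) :
    -- the independence number is finite and attained
    IsGreatest {n : ℕ | ∃ s : Finset V, G.IsNIndepSet n s} G.indepNum ∧
    -- `A_t` maps continuous kernels to continuous functions
    (∀ (t : ℕ) (K : C(PackingGraph.IndepSets G t × PackingGraph.IndepSets G t, ℝ)),
      Continuous (PackingGraph.unionSum G t K)) ∧
    -- convergence at step `α(G)`
    PackingGraph.las G G.indepNum = (G.indepNum : ENNReal) ∧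
    -- every step is an upper bound
    (∀ t : ℕ, 1 ≤ t → (G.indepNum : ENNReal) ≤ PackingGraph.las G t) ∧
    -- the chain is nonincreasing
    (∀ t : ℕ, 1 ≤ t → PackingGraph.las G (t + 1) ≤ PackingGraph.las G t) ∧
    -- and constant from step `α(G)` on
    (∀ t : ℕ, G.indepNum ≤ t → PackingGraph.las G t = (G.indepNum : ENNReal)) := by
  have hconst : ∀ t : ℕ, G.indepNum ≤ t → PackingGraph.las G t = (G.indepNum : ENNReal) := by
    intro t ht
    refine le_antisymm (PackingGraph.las_le_indepNum hG ht) ?_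
    -- The general lower bound needs t ≥ 1 to see singletons; t = 0 forces α = 0.
    rcases Nat.eq_zero_or_pos t with rfl | h
    · simp [Nat.le_zero.1 ht]
    · exact PackingGraph.indepNum_le_las hG h
  exact ⟨hG.isGreatest_indepNum, hG.continuous_unionSum, hconst _ le_rfl,
    fun t ht => PackingGraph.indepNum_le_las hG ht,
    fun t ht => PackingGraph.las_anti hG ht (Nat.le_succ t), hconst⟩
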